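/- Consider finite sequences (possibly empty) $\lambda=(\lambda_1,\dots,\lambda_s)$ of non-negative integers, each colored $a$, $b$ or $u$, in which the final occurrence of each positive colored part may be overlined. Such a sequence is a jagged overpartition if $\lambda_s\notin\{0_a,0_b,\overline{1}_a,\overline{1}_b\}$ (no condition if $s=0$) and for all $1\le i<s$ the difference $\lambda_i-\lambda_{i+1}$ is at least the entry of the following matrix in the row of $\lambda_i$ and the column of the color of $\lambda_{i+1}$ (whether or not $\lambda_{i+1}$ is overlined): $$\begin{array}{c|ccc} & a & b & u\\ \hline \overline a & 2 & 0 & 2\\ \overline b & 2 & 2 & 3\\ \overline u & 1 & 0 & 1\\ a & 1 & -1 & 1\\ b & 1 & 1 & 2\\ u & 0 & -1 & 0\end{array}$$ Let $\overline{C}_1(n;k;i,j)$ denote the number of jagged overpartitions with sum $n$, with $k$ non-overlined parts, $i$ parts colored $a$ and $j$ parts colored $b$, which satisfy the added condition that if the smallest $u$-colored part $x_u$ is equal to the number of overlined parts which come after $x_u$ (with $x_u$ included), then the final part is overlined (no condition if there are no $u$-colored parts). Write $(x;y)_\infty=\prod_{m\ge 0}(1-xy^m)$ and $(x)_\infty=(x;q)_\infty$.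 Then the numbers $\overline{C}_1(n;k;i,j)$ are finite and, as formal power series in $a,b,q$, $$\sum_{n,k,i,j\ge 0}\overline{C}_1(n;k;i,j)\,a^ib^jq^n=\frac{(-q)_\infty(-aq)_\infty(-bq)_\infty}{(q)_\infty(abq;q^2)_\infty}.$$ -/

import Mathlib

open scoped MvPowerSeries.WithPiTopology

/-- The three colors of parts. -/
inductive PartColor
  | a
  | b
  | u

/-- A colored part: a non-negative integer with a color, overlined or not. -/
structure JPart where
  size : ℕ
  color : PartColor
  overlined : Bool

/-- The matrix of minimal differences between a part `x` and the part that follows it, which has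
color `y`. The row is given by the color of `x` and by whether `x` is overlined. The column depends
only on the color of the following part: in the `6 × 6` matrix the columns of the overlined colors
repeat those of the non-overlined ones. -/
def minDiff (overlined : Bool) (x y : PartColor) : ℤ :=
  match overlined, x, y with
  | true, .a, .a => 2
  | true, .a, .b => 0
  | true, .a, .u => 2
  | true, .b, .a => 2
  | true, .b, .b => 2
  | true, .b, .u => 3
  | true, .u, .a => 1
  | true, .u, .b => 0
  | true, .u, .u => 1
  | false, .a, .a => 1
  | false, .a, .b => -1
  | false, .a, .u => 1
  | false, .b, .a => 1
  | false, .b, .b => 1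
  | false, .b, .u => 2
  | false, .u, .a => 0
  | false, .u, .b => -1
  | false, .u, .u => 0

/-- Jagged overpartitions, written as the list `[λ₁, …, λₛ]` of their parts. -/
structure IsJaggedOverpartition (l : List JPart) : Prop where
  /-- Only positive parts may be overlined. -/
  pos_of_overlined : ∀ x ∈ l, x.overlined = true → 0 < x.size
  /-- Only the final occurrence of a (colored) part may be overlined. -/
  final_of_overlined : l.Pairwise fun x y =>
    x.overlined = true → ¬ (y.size = x.size ∧ y.color = x.color)
  /-- The final part is none of `0_a`, `0_b`, overlined `1_a`, overlined `1_b`. -/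
  last_part : ∀ x ∈ l.getLast?,
    x ∉ ({⟨0, .a, false⟩, ⟨0, .b, false⟩, ⟨1, .a, true⟩, ⟨1, .b, true⟩} : Set JPart)
  /-- Successive parts satisfy the difference conditions. -/
  diff : l.IsChain fun x y =>
    minDiff x.overlined x.color y.color ≤ (x.size : ℤ) - (y.size : ℤ)

/-- If a smallest `u`-colored part `x` is equal to the number of overlined parts which come after
`x` (with `x` included), then the final part is overlined. -/
def UCondition (l : List JPart) : Prop :=
  ∀ (l₁ l₂ : List JPart) (x : JPart), l = l₁ ++ x :: l₂ → x.color = .u →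
    (∀ y ∈ l, y.color = .u → x.size ≤ y.size) →
    x.size = (x :: l₂).countP (fun y => y.overlined) →
    ∀ y ∈ l.getLast?, y.overlined = true

open Classical in
/-- The number of parts of `l` of color `c`. -/
noncomputable def numColor (c : PartColor) (l : List JPart) : ℕ :=
  l.countP fun x => x.color = c

/-- The jagged overpartitions of `n` with `k` non-overlined parts, `i` parts of color `a`
and `j` parts of color `b`. -/
def jaggedOverpartitions (n k i j : ℕ) : Set (List JPart) :=
  {l | IsJaggedOverpartition l ∧ (l.map JPart.size).sum = n ∧
    l.countP (fun x => !x.overlined) = k ∧ numColor .a l = i ∧ numColor .b l = j}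

/-- The jagged overpartitions counted by `C̄₁(n;k;i,j)`. -/
def jaggedOverpartitions₁ (n k i j : ℕ) : Set (List JPart) :=
  {l ∈ jaggedOverpartitions n k i j | UCondition l}

/-- The number `C̄₁(n;k;i,j)`. -/
noncomputable def C₁ (n k i j : ℕ) : ℕ :=
  (jaggedOverpartitions₁ n k i j).ncard

/-- The names of the three formal variables `a`, `b`, `q`. -/
inductive GFVar
  | a
  | b
  | q

/-- Formal power series in `a`, `b`, `q` with rational coefficients; sums and products converge
coefficientwise. -/
abbrev GFSeries : Type := MvPowerSeries GFVar ℚ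

/-- The infinite `q`-Pochhammer symbol `(x; y)_∞ = ∏_{m ≥ 0} (1 - x y ^ m)`. -/
noncomputable def qPochInf (x y : GFSeries) : GFSeries :=
  ∏' m : ℕ, (1 - x * y ^ m)

/-- The product defining `(x; y)_∞` converges if `y` has no constant term. -/
theorem multipliable_qPochInf (x y : GFSeries) (hy : MvPowerSeries.constantCoeff y = 0) :
    Multipliable fun m : ℕ => 1 - x * y ^ m := by
  have h : ∀ m : ℕ, (m : ℕ∞) ≤ (-(x * y ^ m)).order := by
    intro m
    rw [MvPowerSeries.order_neg]
    have h1 : (1 : ℕ∞) ≤ y.order := MvPowerSeries.one_le_order_iff_constCoeff_eq_zero.2 hy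
    calc (m : ℕ∞) = m • (1 : ℕ∞) := by simp
      _ ≤ m • y.order := nsmul_le_nsmul_right h1 m
      _ ≤ (y ^ m).order := MvPowerSeries.le_order_pow m
      _ ≤ x.order + (y ^ m).order := le_add_self
      _ ≤ (x * y ^ m).order := MvPowerSeries.le_order_mul
  simp only [sub_eq_add_neg]
  refine MvPowerSeries.WithPiTopology.multipliable_one_add_of_tendsto_order_atTop_nhds_top
    (ENat.tendsto_nhds_top_iff_natCast_lt.2 fun n => ?_)
  filter_upwards [Filter.eventually_gt_atTop n] with m hm
  exact lt_of_lt_of_le (Nat.cast_lt.2 hm) (h m)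

/-! Read a jagged overpartition from its smallest part upwards. The difference matrix splits
(`minDiff_eq`) into a term depending only on colors, a shift of 1 for color `b`, and 1 if the larger
part is overlined. Hence subtracting from each part its color shift and the number of overlined
parts up to and including it leaves a base list whose difference conditions ignore overlining.
Conversely, any base list can be overlined arbitrarily.

An overlined part with `i` larger parts adds `i + 1` to the sum, so the marks form a finite set `D`
of weight `∑ (i + 1)`. A `u`-part equals its count of overlined parts exactly when its reduced size
is 0. The added condition therefore says: if the base list contains `0_u`, its smallest part is
marked. Parts `0_u` weigh nothing and have a forced place. Deleting them loses nothing, because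
their number is recovered as the least one that makes room for all positions in `D`. This gives a
weight-preserving bijection with pairs (base list without `0_u`, arbitrary finite `D`), and the sets
`D` contribute `(-q)_∞`.

For base lists, let `F_c(m)` be the generating function of those lying over a part `m_c`. Splitting
off a possible smallest part gives `F_a(m) = F_u(m) + b q^(m+1) F_b(m)`, `F_b(m) = F_u(m) + a q^m
F_a(m)`, and `(1 - q^m) F_u(m) = (1 + a q^(m+1)) F_a(m+1)` for `m > 0`; for `m = 0` the factor `1 -
q^m` is absent. Eliminating `F_b` and `F_u` expresses `F_a(m)` through `F_a(m+1)`. Iterating, with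
`F_a(m) → 1`, produces the remaining factors. -/

instance : DecidableEq PartColor := fun x y => by
  cases x <;> cases y <;> first | exact isTrue rfl | exact isFalse (by simp)

/-! ### Reduced sizes: separating overlining from the difference conditions -/

/-- A part of a base list: its reduced size and its color. -/
abbrev BasePart : Type := ℕ × PartColor

/-- The amount by which a non-overlined part exceeds its reduced size. -/
def colorShift : PartColor → ℕ
  | .a => 0
  | .b => 1
  | .u => 0

/-- The minimal difference of reduced sizes between a part of color `x` and the next part, of
color `y`. -/
def baseDiff : PartColor → PartColor → ℕ
  | .a, .a => 1
  | .a, .b => 0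
  | .a, .u => 1
  | .b, .a => 0
  | .b, .b => 1
  | .b, .u => 1
  | .u, _ => 0

theorem minDiff_eq (o : Bool) (x y : PartColor) :
    minDiff o x y = baseDiff x y + o.toNat + colorShift x - colorShift y := by
  cases o <;> cases x <;> cases y <;> rfl

/-- The relation between successive parts of a base list, which is written from its smallest part
upwards. -/
def BaseRel (y x : BasePart) : Prop := y.1 + baseDiff x.2 y.2 ≤ x.1

/-- A base list, written from its smallest part upwards: the bottom behaves like a part `0_a`. -/
def IsBase (l : List BasePart) : Prop := List.IsChain BaseRel ((0, .a) :: l)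

theorem le_of_isChain_baseRel {l : List BasePart} {y : BasePart}
    (h : List.IsChain BaseRel (y :: l)) : ∀ x ∈ l, y.1 ≤ x.1 := by
  induction l generalizing y with
  | nil => simp
  | cons z t ih =>
    rw [List.isChain_cons_cons] at h
    have hz : y.1 ≤ z.1 := le_trans (Nat.le_add_right _ _) h.1
    intro x hx
    rcases List.mem_cons.1 hx with rfl | hx
    · exact hz
    · exact hz.trans (ih h.2 x hx)

/-- The list of parts obtained from reduced parts with overlining marks, from the smallest part
upwards: every overlined part adds one to itself and to all larger parts. Below the list there are
`c` overlined parts. -/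
def build : ℕ → List (BasePart × Bool) → List JPart
  | _, [] => []
  | c, x :: t =>
    ⟨x.1.1 + colorShift x.1.2 + c + x.2.toNat, x.1.2, x.2⟩ :: build (c + x.2.toNat) t

theorem build_injective (c : ℕ) : Function.Injective (build c) := by
  intro l
  induction l generalizing c with
  | nil => intro l' h; cases l' <;> simp_all [build]
  | cons x t ih =>
    intro l' h
    cases l' with
    | nil => simp [build] at h
    | cons x' t' =>
      obtain ⟨⟨n, k⟩, o⟩ := x
      obtain ⟨⟨n', k'⟩, o'⟩ := x'
      simp only [build, List.cons.injEq, JPart.mk.injEq] at h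
      obtain ⟨⟨h1, rfl, rfl⟩, h2⟩ := h
      rw [ih _ h2]
      simp at h1
      rw [h1]

theorem build_append (c : ℕ) (l m : List (BasePart × Bool)) :
    build c (l ++ m) = build c l ++ build (c + l.countP (·.2)) m := by
  induction l generalizing c with
  | nil => simp [build]
  | cons x t ih =>
    obtain ⟨x, o⟩ := x
    cases o <;> simp [build, ih, add_assoc, add_comm]

theorem countP_build (c : ℕ) (l : List (BasePart × Bool)) (p : PartColor → Bool → Bool) :
    (build c l).countP (fun x => p x.color x.overlined) = l.countP (fun x => p x.1.2 x.2) := by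
  induction l generalizing c with
  | nil => rfl
  | cons x t ih => simp [build, List.countP_cons, ih]

/-- Both the color shifts and the overlining term of `minDiff_eq` cancel against the increments made
by `build`, so the marks drop out. -/
theorem isChain_build (c : ℕ) (l : List (BasePart × Bool)) :
    (build c l).IsChain (fun y x => minDiff x.overlined x.color y.color ≤
      (x.size : ℤ) - (y.size : ℤ)) ↔ (l.map Prod.fst).IsChain BaseRel := by
  induction l generalizing c with
  | nil => simp [build]
  | cons y t ih =>
    cases t with
    | nil => simp [build]
    | cons x t =>
      have := ih (c + y.2.toNat)
      simp only [build, List.isChain_cons_cons, List.map_cons] at this ⊢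
      rw [this, minDiff_eq, BaseRel]
      refine and_congr_left fun _ => ?_
      push_cast
      omega

theorem le_size_build {c : ℕ} {l : List (BasePart × Bool)} {y : BasePart}
    (h : List.IsChain BaseRel (y :: l.map Prod.fst)) :
    ∀ x ∈ build c l, y.1 + colorShift x.color + c + x.overlined.toNat ≤ x.size := by
  induction l generalizing c y with
  | nil => simp [build]
  | cons z t ih =>
    rw [List.map_cons, List.isChain_cons_cons, BaseRel] at h
    intro x hx
    rw [build, List.mem_cons] at hx
    rcases hx with rfl | hx
    · simp only
      omega
    · have := ih h.2 x hx
      omega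

/-- The rule on final occurrences is automatic: an overlined part strictly exceeds every part of its
color below it. -/
theorem pairwise_build {c : ℕ} {l : List (BasePart × Bool)}
    (h : List.IsChain BaseRel (l.map Prod.fst)) :
    (build c l).Pairwise fun y x =>
      x.overlined = true → ¬ (y.size = x.size ∧ y.color = x.color) := by
  induction l generalizing c with
  | nil => simp [build]
  | cons y t ih =>
    rw [build, List.pairwise_cons]
    refine ⟨fun x hx hxo => ?_, ih h.tail⟩
    have := le_size_build h x hx
    rintro ⟨h1, h2⟩
    simp only [hxo, Bool.toNat_true] at this h1 h2
    rw [← h2] at this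
    omega

/-- Since `baseDiff` is nonnegative, reduced sizes weakly increase. Once the smallest is
nonnegative, no truncated subtraction loses anything. -/
theorem exists_build_eq {c : ℕ} {l : List JPart}
    (h : l.IsChain (fun y x => minDiff x.overlined x.color y.color ≤
      (x.size : ℤ) - (y.size : ℤ)))
    (h0 : ∀ x ∈ l.head?, colorShift x.color + c + x.overlined.toNat ≤ x.size) :
    ∃ m, build c m = l := by
  induction l generalizing c with
  | nil => exact ⟨[], rfl⟩
  | cons x t ih =>
    have hx := h0 x rfl
    obtain ⟨m, hm⟩ := ih (c := c + x.overlined.toNat) h.tail (by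
      intro y hy
      have := h.rel_head? hy
      rw [minDiff_eq] at this
      omega)
    refine ⟨((x.size - (colorShift x.color + c + x.overlined.toNat), x.color), x.overlined) :: m, ?_⟩
    simp only [build, hm]
    congr 1
    cases x
    simp only [JPart.mk.injEq, and_true] at hx ⊢
    omega

/-- The forbidden final parts `0_a` and overlined `1_a` are those of reduced size 0 and color `a`,
which a bottom `0_a` rules out; `0_b` and overlined `1_b` would have reduced size -1. -/
theorem isJaggedOverpartition_reverse_build {l : List (BasePart × Bool)} :
    IsJaggedOverpartition (build 0 l).reverse ↔ IsBase (l.map Prod.fst) := by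
  constructor
  · intro h
    have h1 := h.diff
    rw [List.isChain_reverse, isChain_build] at h1
    rw [IsBase, List.isChain_cons]
    refine ⟨fun x hx => ?_, h1⟩
    have h2 := h.last_part
    cases l with
    | nil => simp at hx
    | cons y t =>
      obtain ⟨⟨n, k⟩, o⟩ := y
      simp at hx
      subst hx
      rw [BaseRel]
      cases k <;> cases o <;> simp [build, baseDiff, colorShift] at h2 ⊢ <;> omega
  · intro h
    refine ⟨fun x hx hxo => ?_, ?_, fun x hx => ?_, ?_⟩
    · have := le_size_build h x (List.mem_reverse.1 hx)
      rw [hxo, Bool.toNat_true] at this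
      omega
    · rw [List.pairwise_reverse]
      exact pairwise_build h.tail
    · cases l with
      | nil => simp [build] at hx
      | cons y t =>
        obtain ⟨⟨n, k⟩, o⟩ := y
        rw [List.map_cons, IsBase, List.isChain_cons_cons, BaseRel] at h
        have h1 := h.1
        simp [build] at hx
        subst hx
        cases k <;> cases o <;> simp [baseDiff, colorShift] at h1 ⊢ <;> omega
    · rw [List.isChain_reverse, isChain_build]
      exact h.tail

theorem exists_reverse_build_eq {l : List JPart} (h : IsJaggedOverpartition l) :
    ∃ m, (build 0 m).reverse = l := by
  obtain ⟨m, hm⟩ := exists_build_eq (c := 0) (l := l.reverse) (by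
    rw [List.isChain_reverse]; exact h.diff) (by
      intro x hx
      rw [List.head?_reverse] at hx
      have h2 := h.last_part x hx
      have h3 := h.pos_of_overlined x (List.mem_of_getLast? hx)
      obtain ⟨n, k, o⟩ := x
      cases k <;> cases o <;> simp [colorShift] at h2 h3 ⊢ <;> omega)
  exact ⟨m, by rw [hm, List.reverse_reverse]⟩

theorem exists_append_of_build_eq {c : ℕ} {l : List (BasePart × Bool)} {p s : List JPart} {x : JPart}
    (h : build c l = p ++ x :: s) :
    ∃ p' y s', l = p' ++ y :: s' ∧ build c p' = p ∧
      x = ⟨y.1.1 + colorShift y.1.2 + (c + p'.countP (·.2)) + y.2.toNat, y.1.2, y.2⟩ := by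
  induction p generalizing c l with
  | nil =>
    cases l with
    | nil => simp [build] at h
    | cons y t =>
      simp only [build, List.nil_append, List.cons.injEq] at h
      exact ⟨[], y, t, rfl, rfl, by simp [← h.1]⟩
  | cons z p ih =>
    cases l with
    | nil => simp [build] at h
    | cons y t =>
      simp only [build, List.cons_append, List.cons.injEq] at h
      obtain ⟨p', w, s', rfl, h1, h2⟩ := ih h.2
      refine ⟨y :: p', w, s', rfl, by simp [build, h1, h.1], ?_⟩
      rw [h2]
      cases hy : y.2 <;> simp [hy] <;> omega

theorem exists_first_of_mem {α : Type*} {p : α → Prop} {l : List α} (h : ∃ x ∈ l, p x) :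
    ∃ l₁ x l₂, l = l₁ ++ x :: l₂ ∧ p x ∧ ∀ y ∈ l₁, ¬ p y := by
  induction l with
  | nil => simp at h
  | cons z t ih =>
    by_cases hz : p z
    · exact ⟨[], z, t, rfl, hz, by simp⟩
    · obtain ⟨l₁, x, l₂, rfl, hx, h1⟩ := ih (by simpa [hz] using h)
      exact ⟨z :: l₁, x, l₂, rfl, hx, by simpa [hz] using h1⟩

theorem uCondition_reverse_build {l : List (BasePart × Bool)} (h : IsBase (l.map Prod.fst)) :
    UCondition (build 0 l).reverse ↔
      ((0, PartColor.u) ∈ l.map Prod.fst → ∀ x ∈ l.head?, x.2 = true) := by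
  have hhead : (∀ y ∈ (build 0 l).reverse.getLast?, y.overlined = true) ↔
      ∀ x ∈ l.head?, x.2 = true := by
    cases l <;> simp [build]
  rw [UCondition, hhead]
  constructor
  · intro hU hmem
    obtain ⟨w, hw, hw0⟩ := List.mem_map.1 hmem
    -- The lowest `u`-part is a smallest one, and its reduced size is 0 because some `0_u` occurs.
    obtain ⟨l₁, x, l₂, rfl, hx, hl₁⟩ :=
      exists_first_of_mem (p := fun x : BasePart × Bool => x.1.2 = .u) ⟨w, hw, by rw [hw0]⟩
    have hchain : List.IsChain BaseRel (x.1 :: l₂.map Prod.fst) := by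
      have := h.tail
      simp only [List.tail_cons, List.map_append, List.map_cons] at this
      exact this.right_of_append
    have hx0 : x.1.1 = 0 := by
      rcases List.mem_append.1 hw with hw | hw
      · exact absurd (by rw [hw0]) (hl₁ w hw)
      · rcases List.mem_cons.1 hw with rfl | hw
        · rw [hw0]
        · have := le_of_isChain_baseRel hchain w.1 (List.mem_map_of_mem hw)
          rw [hw0] at this
          exact Nat.le_zero.1 this
    have hcount := countP_build 0 l₁ (fun _ o => o)
    refine hU _ (build 0 l₁).reverse _ (by
      rw [build_append, build, List.reverse_append, List.reverse_cons, List.append_assoc,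
        List.singleton_append]) hx (fun y hy hyu => ?_) ?_
    · rw [List.mem_reverse, build_append, build, List.mem_append, List.mem_cons] at hy
      rcases hy with hy | rfl | hy
      · exfalso
        obtain ⟨p, s, hps⟩ := List.append_of_mem hy
        obtain ⟨p', z, s', rfl, -, rfl⟩ := exists_append_of_build_eq hps
        exact hl₁ z (by simp) hyu
      · exact le_rfl
      · have := le_size_build hchain y hy
        simp only [hx, colorShift]
        omega
    · simp only [List.countP_cons, List.countP_reverse, hcount, hx0, hx, colorShift]
      cases x.2 <;> simp
  · intro hh m₁ m₂ x hx hxu _ hcount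
    refine hh ?_
    have hx' : build 0 l = m₂.reverse ++ x :: m₁.reverse := by
      rw [← List.reverse_reverse (build 0 l), hx]
      simp
    obtain ⟨p, y, s, rfl, h1, rfl⟩ := exists_append_of_build_eq hx'
    simp only at hxu
    have hcount' := countP_build 0 p (fun _ o => o)
    rw [h1, List.countP_reverse] at hcount'
    simp only [List.countP_cons, hcount', hxu, colorShift] at hcount
    have hy : y.1 = (0, PartColor.u) := by
      refine Prod.ext ?_ hxu
      cases hy : y.2 <;> simp [hy] at hcount ⊢ <;> omega
    simp [hy]

/-! ### Overlinings as finite sets of positions counted from the largest part -/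

/-- Mark the parts of a base list whose number of larger parts is in `D`. -/
def mark (D : Finset ℕ) : List BasePart → List (BasePart × Bool)
  | [] => []
  | x :: t => (x, decide (t.length ∈ D)) :: mark D t

/-- The numbers of larger parts for all marked parts. -/
def marks : List (BasePart × Bool) → Finset ℕ
  | [] => ∅
  | x :: t => if x.2 then insert t.length (marks t) else marks t

theorem map_fst_mark (D : Finset ℕ) (l : List BasePart) : (mark D l).map Prod.fst = l := by
  induction l with
  | nil => rfl
  | cons x t ih => simp [mark, ih]

theorem length_mark (D : Finset ℕ) (l : List BasePart) : (mark D l).length = l.length := by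
  rw [← List.length_map (f := Prod.fst), map_fst_mark]

theorem mark_congr {D D' : Finset ℕ} {l : List BasePart}
    (h : ∀ i < l.length, i ∈ D ↔ i ∈ D') : mark D l = mark D' l := by
  induction l with
  | nil => rfl
  | cons x t ih =>
    rw [mark, mark, ih fun i hi => h i (hi.trans (Nat.lt_succ_self _))]
    simp [h t.length (Nat.lt_succ_self _)]

theorem lt_of_mem_marks {l : List (BasePart × Bool)} {i : ℕ} (h : i ∈ marks l) :
    i < l.length := by
  induction l with
  | nil => simp [marks] at h
  | cons x t ih =>
    rw [marks] at h
    rw [List.length_cons]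
    split_ifs at h
    · rcases Finset.mem_insert.1 h with rfl | h
      · exact Nat.lt_succ_self _
      · exact (ih h).trans (Nat.lt_succ_self _)
    · exact (ih h).trans (Nat.lt_succ_self _)

theorem mark_marks (l : List (BasePart × Bool)) : mark (marks l) (l.map Prod.fst) = l := by
  induction l with
  | nil => rfl
  | cons x t ih =>
    have hc : mark (marks (x :: t)) (t.map Prod.fst) = t := by
      rw [mark_congr (D' := marks t), ih]
      intro i hi
      rw [List.length_map] at hi
      rw [marks]
      split_ifs <;> simp [hi.ne]
    have hx : decide (t.length ∈ marks (x :: t)) = x.2 := by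
      have : t.length ∉ marks t := fun h => lt_irrefl _ (lt_of_mem_marks h)
      cases hx : x.2 <;> simp [marks, hx, this]
    rw [List.map_cons, mark, hc, List.length_map, hx]

theorem mem_marks_mark {D : Finset ℕ} {l : List BasePart} {i : ℕ} :
    i ∈ marks (mark D l) ↔ i ∈ D ∧ i < l.length := by
  induction l with
  | nil => simp [mark, marks]
  | cons x t ih =>
    rw [mark, marks, List.length_cons, Nat.lt_succ_iff_lt_or_eq, and_or_left, ← ih, length_mark]
    by_cases h : t.length ∈ D
    · simp only [h, decide_true, if_true, Finset.mem_insert]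
      constructor
      · rintro (rfl | h')
        · exact Or.inr ⟨h, rfl⟩
        · exact Or.inl h'
      · rintro (h' | h')
        · exact Or.inr h'
        · exact Or.inl h'.2
    · simp only [h, decide_false]
      constructor
      · exact Or.inl
      · rintro (h' | ⟨h', rfl⟩)
        · exact h'
        · exact absurd h' h

theorem marks_mark {D : Finset ℕ} {l : List BasePart} (h : ∀ i ∈ D, i < l.length) :
    marks (mark D l) = D := by
  ext i
  rw [mem_marks_mark]
  exact ⟨And.left, fun hi => ⟨hi, h i hi⟩⟩

/-! ### Removing and restoring the parts `0_u` -/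

/-- Insert `r` parts `0_u` after the other parts of size `0`. -/
def pad (r : ℕ) : List BasePart → List BasePart
  | [] => List.replicate r (0, .u)
  | x :: t => if x.1 = 0 then x :: pad r t else List.replicate r (0, .u) ++ x :: t

theorem pad_perm (r : ℕ) (l : List BasePart) :
    (pad r l).Perm (List.replicate r (0, .u) ++ l) := by
  induction l with
  | nil => simp [pad]
  | cons x t ih =>
    rw [pad]
    split_ifs
    · exact (ih.cons x).trans List.perm_middle.symm
    · exact List.Perm.refl _

theorem filter_pad {r : ℕ} {l : List BasePart} (h : (0, PartColor.u) ∉ l) :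
    (pad r l).filter (· ≠ (0, PartColor.u)) = l := by
  have hf : ∀ m : List BasePart, (0, PartColor.u) ∉ m →
      m.filter (· ≠ (0, PartColor.u)) = m := fun m hm =>
    List.filter_eq_self.2 fun x hx => by
      simp only [ne_eq, decide_not, Bool.not_eq_true', decide_eq_false_iff_not]
      rintro rfl
      exact hm hx
  induction l with
  | nil => simp [pad]
  | cons x t ih =>
    rw [List.mem_cons, not_or] at h
    rw [pad]
    split_ifs
    · rw [List.filter_cons_of_pos (by simpa using Ne.symm h.1), ih h.2]
    · rw [List.filter_append, hf (x :: t) (by simpa using h)]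
      simp

theorem baseRel_of_pos {y x : BasePart} (hy : y.1 = 0) (hx : 0 < x.1) : BaseRel y x := by
  obtain ⟨n, k⟩ := x
  obtain ⟨n', k'⟩ := y
  cases k <;> cases k' <;> simp [BaseRel, baseDiff] at hx hy ⊢ <;> omega

theorem isChain_replicate_append {r : ℕ} {y : BasePart} {l : List BasePart} (hy : y.1 = 0)
    (h : List.IsChain BaseRel (y :: l)) (h0 : ∀ x ∈ l.head?, 0 < x.1) :
    List.IsChain BaseRel (y :: (List.replicate r (0, .u) ++ l)) := by
  induction r generalizing y with
  | zero => simpa using h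
  | succ r ih =>
    rw [List.replicate_succ, List.cons_append, List.isChain_cons_cons]
    refine ⟨by simp [BaseRel, baseDiff, hy], ih rfl ?_⟩
    rw [List.isChain_cons]
    refine ⟨fun x hx => ?_, h.tail⟩
    exact baseRel_of_pos rfl (h0 x hx)

theorem isChain_pad {r : ℕ} {y : BasePart} {l : List BasePart} (hy : y.1 = 0)
    (h : List.IsChain BaseRel (y :: l)) : List.IsChain BaseRel (y :: pad r l) := by
  induction l generalizing y with
  | nil => simpa [pad] using isChain_replicate_append (r := r) hy h (by simp)
  | cons x t ih =>
    rw [pad]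
    split_ifs with hx
    · rw [List.isChain_cons_cons] at h ⊢
      exact ⟨h.1, ih hx h.2⟩
    · exact isChain_replicate_append hy h (by simpa using Nat.pos_of_ne_zero hx)

/-- Colors `a` and `b` must rise by 1 over a `u`-part. Hence the parts `0_u` form one block directly
above the other zero parts, and `pad` has only one place to put them. -/
theorem eq_or_pos_of_isChain {l : List BasePart}
    (h : List.IsChain BaseRel ((0, .u) :: l)) : ∀ x ∈ l, x = (0, .u) ∨ 0 < x.1 := by
  induction l with
  | nil => simp
  | cons x t ih =>
    rw [List.isChain_cons_cons] at h
    have hx : x = (0, .u) ∨ 0 < x.1 := by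
      have h1 := h.1
      obtain ⟨n, k⟩ := x
      cases k <;> simp [BaseRel, baseDiff] at h1 ⊢ <;> omega
    intro z hz
    rcases List.mem_cons.1 hz with rfl | hz'
    · exact hx
    · rcases hx with rfl | hx
      · exact ih h.2 z hz'
      · exact Or.inr (hx.trans_le (le_of_isChain_baseRel h.2 z hz'))

theorem isChain_filter {y : BasePart} {l : List BasePart} (h : List.IsChain BaseRel (y :: l)) :
    List.IsChain BaseRel (y :: l.filter (· ≠ (0, PartColor.u))) := by
  induction l generalizing y with
  | nil => simp
  | cons x t ih =>
    have hy := le_of_isChain_baseRel h x (by simp)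
    rw [List.isChain_cons_cons] at h
    by_cases hx : x = (0, .u)
    · subst hx
      rw [List.filter_cons_of_neg (by simp)]
      have hf := ih h.2
      rw [List.isChain_cons]
      refine ⟨fun z hz => baseRel_of_pos (Nat.le_zero.1 hy) ?_, hf.tail⟩
      have hz := List.mem_filter.1 (List.mem_of_mem_head? hz)
      exact (eq_or_pos_of_isChain h.2 z hz.1).resolve_left (by simpa using hz.2)
    · rw [List.filter_cons_of_pos (by simpa using hx), List.isChain_cons_cons]
      exact ⟨h.1, ih h.2⟩

theorem pad_of_pos {r : ℕ} {l : List BasePart} (h : ∀ x ∈ l, 0 < x.1) :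
    pad r l = List.replicate r (0, .u) ++ l := by
  cases l with
  | nil => simp [pad]
  | cons x t => rw [pad, if_neg (h x (by simp)).ne']

theorem pad_zero (l : List BasePart) : pad 0 l = l := by
  induction l with
  | nil => rfl
  | cons x t ih => simp [pad, ih]

theorem pad_count_filter {l : List BasePart} (h : List.IsChain BaseRel l) :
    pad (l.count (0, .u)) (l.filter (· ≠ (0, PartColor.u))) = l := by
  induction l with
  | nil => rfl
  | cons x t ih =>
    have ih := ih h.tail
    by_cases hx : x = (0, .u)
    · subst hx
      have hp : ∀ x ∈ t.filter (· ≠ (0, PartColor.u)), 0 < x.1 := by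
        intro x hx
        rw [List.mem_filter] at hx
        exact (eq_or_pos_of_isChain h x hx.1).resolve_left (by simpa using hx.2)
      rw [pad_of_pos hp] at ih
      rw [List.filter_cons_of_neg (by simp), List.count_cons_self, pad_of_pos hp,
        List.replicate_succ, List.cons_append, ih]
    · rw [List.filter_cons_of_pos (by simpa using hx), List.count_cons_of_ne (by simpa using hx),
        pad]
      split_ifs with hx0
      · rw [ih]
      · have h0 : ∀ y ∈ t, 0 < y.1 := fun y hy =>
          (Nat.pos_of_ne_zero hx0).trans_le (le_of_isChain_baseRel h y hy)
        have h1 : (0, PartColor.u) ∉ t := fun hm => lt_irrefl _ (h0 _ hm)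
        rw [List.count_eq_zero_of_not_mem h1] at ih ⊢
        rw [pad_zero] at ih
        rw [ih]
        rfl

/-! ### The bijection with pairs (base list, finite set) -/

/-- The jagged overpartition that arises from a base list without parts `0_u` and a set of
positions. -/
def encode (p : List BasePart × Finset ℕ) : List JPart :=
  (build 0 (mark p.2 (pad (p.2.sup Nat.succ - p.1.length) p.1))).reverse

/-- The base lists without parts `0_u`, on top of the part `y`. -/
def basesOver (y : BasePart) : Set (List BasePart) :=
  {l | List.IsChain BaseRel (y :: l) ∧ (0, PartColor.u) ∉ l}

theorem length_pad (r : ℕ) (l : List BasePart) : (pad r l).length = r + l.length := by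
  rw [(pad_perm r l).length_eq, List.length_append, List.length_replicate]

theorem lt_length_pad {D : Finset ℕ} {l : List BasePart} :
    ∀ i ∈ D, i < (pad (D.sup Nat.succ - l.length) l).length := by
  intro i hi
  have : Nat.succ i ≤ D.sup Nat.succ := Finset.le_sup (f := Nat.succ) hi
  rw [length_pad]
  omega

theorem encode_injOn : Set.InjOn encode (basesOver (0, .a) ×ˢ Set.univ) := by
  rintro ⟨k, D⟩ ⟨⟨-, hk⟩, -⟩ ⟨k', D'⟩ ⟨⟨-, hk'⟩, -⟩ h
  have h1 := build_injective 0 (List.reverse_injective h)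
  simp only at h1 hk hk'
  have h2 := congrArg (List.map Prod.fst) h1
  rw [map_fst_mark, map_fst_mark] at h2
  have h3 := congrArg marks h1
  rw [marks_mark lt_length_pad, marks_mark lt_length_pad] at h3
  have h4 := congrArg (List.filter (· ≠ (0, PartColor.u))) h2
  rw [filter_pad hk, filter_pad hk'] at h4
  rw [h3, h4]

theorem mapsTo_encode : Set.MapsTo encode (basesOver (0, .a) ×ˢ Set.univ)
    {l | IsJaggedOverpartition l ∧ UCondition l} := by
  rintro ⟨k, D⟩ ⟨⟨hc, hk⟩, -⟩
  simp only at hc hk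
  have hb : IsBase ((mark D (pad (D.sup Nat.succ - k.length) k)).map Prod.fst) := by
    rw [map_fst_mark]
    exact isChain_pad rfl hc
  refine ⟨isJaggedOverpartition_reverse_build.2 hb, (uCondition_reverse_build hb).2 ?_⟩
  rw [map_fst_mark]
  intro hu x hx
  -- If padding occurs, the padded length is exactly `max D + 1`, so the smallest part sits at
  -- position `max D` and is marked.
  have hr : D.sup Nat.succ - k.length ≠ 0 := by
    intro h0
    rw [h0, pad_zero] at hu
    exact hk hu
  have hlen := length_pad (D.sup Nat.succ - k.length) k
  cases hp : pad (D.sup Nat.succ - k.length) k with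
  | nil => simp [hp, mark] at hx
  | cons z t =>
    rw [hp, mark, List.head?_cons, Option.mem_some_iff] at hx
    subst hx
    have hD : D.Nonempty := by
      rw [Finset.nonempty_iff_ne_empty]
      rintro rfl
      simp at hr
    obtain ⟨i, hi, his⟩ := Finset.exists_mem_eq_sup D hD Nat.succ
    rw [hp, List.length_cons] at hlen
    have : t.length = i := by omega
    simpa [this] using hi

theorem surjOn_encode : Set.SurjOn encode (basesOver (0, .a) ×ˢ Set.univ)
    {l | IsJaggedOverpartition l ∧ UCondition l} := by
  rintro l ⟨hl, hu⟩
  obtain ⟨m, rfl⟩ := exists_reverse_build_eq hl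
  have hb := isJaggedOverpartition_reverse_build.1 hl
  rw [uCondition_reverse_build hb] at hu
  have hpad := pad_count_filter hb.tail
  rw [List.tail_cons] at hpad
  set k := (m.map Prod.fst).filter (· ≠ (0, PartColor.u)) with hk
  have hlen := length_pad ((m.map Prod.fst).count (0, .u)) k
  rw [hpad, List.length_map] at hlen
  have hsup : (marks m).sup Nat.succ ≤ m.length :=
    Finset.sup_le fun i hi => lt_of_mem_marks hi
  -- If `0_u` occurs, the marked smallest part makes the supremum equal to the full length;
  -- otherwise both sides vanish.
  have hr : (marks m).sup Nat.succ - k.length = (m.map Prod.fst).count (0, .u) := by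
    by_cases h0 : (0, PartColor.u) ∈ m.map Prod.fst
    · have := hu h0
      cases m with
      | nil => simp at h0
      | cons x t =>
        have h1 : t.length ∈ marks (x :: t) := by simp [marks, this x rfl]
        have h2 : Nat.succ t.length ≤ _ := Finset.le_sup (f := Nat.succ) h1
        rw [List.length_cons] at hsup hlen
        omega
    · rw [List.count_eq_zero_of_not_mem h0] at hlen ⊢
      omega
  have hku : (0, PartColor.u) ∉ k := by simp [hk]
  refine ⟨(k, marks m), ⟨⟨?_, hku⟩, trivial⟩, ?_⟩
  · exact isChain_filter hb
  · rw [encode, hr, hpad, mark_marks]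

/-! ### Weights and finiteness -/

instance : Finite PartColor :=
  Finite.of_injective (fun c : PartColor => (c.rec 0 1 2 : Fin 3)) fun x y h => by
    cases x <;> cases y <;> first | rfl | simp at h

/-- The exponent that records the color of a part. -/
noncomputable def colorExp : PartColor → GFVar →₀ ℕ
  | .a => Finsupp.single .a 1
  | .b => Finsupp.single .b 1
  | .u => 0

/-- The exponent of the monomial of a part of a base list. -/
noncomputable def partExp (x : BasePart) : GFVar →₀ ℕ :=
  colorExp x.2 + Finsupp.single .q (x.1 + colorShift x.2)

/-- The exponent of the monomial of a base list. -/
noncomputable def listExp (l : List BasePart) : GFVar →₀ ℕ := (l.map partExp).sum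

/-- The exponent of the monomial of a list of parts. -/
noncomputable def jaggedExp (l : List JPart) : GFVar →₀ ℕ :=
  (l.map fun x => colorExp x.color + Finsupp.single .q x.size).sum

theorem listExp_cons (x : BasePart) (l : List BasePart) :
    listExp (x :: l) = partExp x + listExp l := by simp [listExp]

theorem listExp_pad (r : ℕ) (l : List BasePart) : listExp (pad r l) = listExp l := by
  rw [listExp, ((pad_perm r l).map partExp).sum_eq]
  simp [listExp, partExp, colorExp, colorShift]

/-- A mark at position `i` raises its own part and the `i` larger ones; the `c` overlined parts
underneath raise every part. -/
theorem jaggedExp_build_mark (c : ℕ) (D : Finset ℕ) (l : List BasePart) :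
    jaggedExp (build c (mark D l)) = listExp l + Finsupp.single .q
      (c * l.length + ∑ i ∈ Finset.range l.length, if i ∈ D then i + 1 else 0) := by
  induction l generalizing c with
  | nil => simp [mark, build, jaggedExp, listExp]
  | cons x t ih =>
    have := ih (c + (decide (t.length ∈ D)).toNat)
    rw [jaggedExp] at this
    rw [mark, build, jaggedExp, List.map_cons, List.sum_cons, this, listExp_cons, partExp,
      List.length_cons, Finset.sum_range_succ, add_add_add_comm, ← Finsupp.single_add,
      add_right_comm (colorExp x.2) (Finsupp.single .q (x.1 + colorShift x.2)),
      add_assoc (colorExp x.2 + listExp t), ← Finsupp.single_add]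
    congr 2
    by_cases h : t.length ∈ D <;> simp [h] <;> ring

theorem jaggedExp_reverse (l : List JPart) : jaggedExp l.reverse = jaggedExp l := by
  rw [jaggedExp, jaggedExp, ((List.reverse_perm l).map _).sum_eq]

theorem jaggedExp_encode (p : List BasePart × Finset ℕ) :
    jaggedExp (encode p) = listExp p.1 + Finsupp.single .q (∑ i ∈ p.2, (i + 1)) := by
  rw [encode, jaggedExp_reverse, jaggedExp_build_mark, listExp_pad, zero_mul, zero_add,
    Finset.sum_ite_mem, Finset.inter_eq_right.2]
  intro i hi
  exact Finset.mem_range.2 (lt_length_pad i hi)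

theorem jaggedExp_eq (l : List JPart) :
    jaggedExp l = Finsupp.single .a (numColor .a l) + Finsupp.single .b (numColor .b l) +
      Finsupp.single .q (l.map JPart.size).sum := by
  induction l with
  | nil => simp [jaggedExp, numColor]
  | cons x t ih =>
    rw [jaggedExp] at ih
    rw [jaggedExp, List.map_cons, List.sum_cons, ih]
    obtain ⟨n, k, o⟩ := x
    cases k <;> simp [numColor, colorExp, Finsupp.single_add] <;> abel

theorem summable_monomial {α : Type*} {w : α → GFVar →₀ ℕ} (h : ∀ d, {x | w x = d}.Finite) :
    Summable fun x => (MvPowerSeries.monomial (w x) 1 : GFSeries) := by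
  classical
  rw [MvPowerSeries.WithPiTopology.summable_iff_summable_coeff]
  refine fun d => summable_of_hasFiniteSupport ((h d).subset fun x hx => ?_)
  rw [Function.mem_support, MvPowerSeries.coeff_monomial] at hx
  by_contra hne
  exact hx (if_neg fun h => hne h.symm)

theorem degree_partExp {x : BasePart} (hx : x ≠ (0, .u)) :
    1 ≤ (partExp x).degree ∧ x.1 ≤ (partExp x).degree := by
  obtain ⟨n, k⟩ := x
  cases k <;> simp [partExp, colorExp, colorShift] at hx ⊢ <;> omega

/-- Only `0_u` has degree 0. Without it the degree bounds both the length and the sizes, so each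
degree admits finitely many lists. -/
theorem degree_listExp {l : List BasePart} (hl : (0, PartColor.u) ∉ l) :
    l.length ≤ (listExp l).degree ∧ ∀ x ∈ l, x.1 ≤ (listExp l).degree := by
  induction l with
  | nil => simp
  | cons y t ih =>
    rw [List.mem_cons, not_or] at hl
    obtain ⟨h1, h2⟩ := ih hl.2
    obtain ⟨h3, h4⟩ := degree_partExp (Ne.symm hl.1)
    rw [listExp_cons, map_add]
    refine ⟨by rw [List.length_cons]; omega, fun x hx => ?_⟩
    rcases List.mem_cons.1 hx with rfl | hx
    · omega
    · have := h2 x hx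
      omega

theorem finite_degree_listExp_le (n : ℕ) :
    {l : List BasePart | (0, PartColor.u) ∉ l ∧ (listExp l).degree ≤ n}.Finite := by
  have hS : Finite {x : BasePart | x.1 ≤ n} :=
    ((Set.finite_Iic n).prod (Set.finite_univ (α := PartColor))).subset fun x hx => ⟨hx, trivial⟩
  refine ((List.finite_length_le {x : BasePart | x.1 ≤ n} n).image
    (List.map Subtype.val)).subset ?_
  rintro l ⟨hl, hn⟩
  obtain ⟨h1, h2⟩ := degree_listExp hl
  refine ⟨l.pmap Subtype.mk fun x hx => (h2 x hx).trans hn, ?_, ?_⟩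
  · rw [Set.mem_ofPred_eq, List.length_pmap]
    exact h1.trans hn
  · rw [List.map_pmap]
    simp

/-! ### Recurrences for the generating functions of base lists -/

/-- The generating function of a set of base lists. -/
noncomputable def baseGF (S : Set (List BasePart)) : GFSeries :=
  ∑' l : S, MvPowerSeries.monomial (listExp l) 1

theorem summable_baseGF {S : Set (List BasePart)} (hS : ∀ l ∈ S, (0, PartColor.u) ∉ l) :
    Summable fun l : S => (MvPowerSeries.monomial (listExp l) 1 : GFSeries) :=
  summable_monomial fun d => Set.Finite.of_finite_image (f := Subtype.val)
    ((finite_degree_listExp_le d.degree).subset (by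
      rintro _ ⟨l, rfl, rfl⟩
      exact ⟨hS l l.2, le_rfl⟩)) Subtype.val_injective.injOn

/-- The base lists without parts `0_u` whose smallest part has property `P`. -/
def basesWith (P : BasePart → Prop) : Set (List BasePart) :=
  {l | List.IsChain BaseRel l ∧ (∀ x ∈ l.head?, P x) ∧ (0, PartColor.u) ∉ l}

theorem basesOver_eq (y : BasePart) : basesOver y = basesWith (BaseRel y) := by
  ext l
  simp only [basesOver, basesWith, Set.mem_ofPred_eq, List.isChain_cons]
  tauto

/-- Splits the lists by whether the smallest part is `z`; if so, the rest is any list over `z`. -/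
theorem baseGF_insert {P Q : BasePart → Prop} {z : BasePart} (hz : z ≠ (0, .u)) (hQ : ¬ Q z)
    (h : ∀ x ≠ (0, .u), P x ↔ Q x ∨ x = z) :
    baseGF (basesWith P) = baseGF (basesWith Q) +
      MvPowerSeries.monomial (partExp z) 1 * baseGF (basesOver z) := by
  have hunion : basesWith P = basesWith Q ∪ List.cons z '' basesOver z := by
    ext l
    cases l with
    | nil => simp [basesWith]
    | cons x t =>
      by_cases hx : x = (0, .u)
      · simp [basesWith, hx, hz]
      · have hx' : (0, PartColor.u) ≠ x := Ne.symm hx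
        simp only [basesWith, basesOver, Set.mem_union, Set.mem_image, Set.mem_ofPred_eq,
          List.head?_cons, Option.mem_some_iff, forall_eq', h x hx, List.mem_cons, hx', false_or,
          List.cons.injEq]
        constructor
        · rintro ⟨h1, h2 | rfl, h3⟩
          · exact Or.inl ⟨h1, h2, h3⟩
          · exact Or.inr ⟨t, ⟨h1, h3⟩, rfl, rfl⟩
        · rintro (⟨h1, h2, h3⟩ | ⟨t', ⟨h1, h2⟩, rfl, rfl⟩)
          · exact ⟨h1, Or.inl h2, h3⟩
          · exact ⟨h1, Or.inr rfl, h2⟩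
  have hdisj : Disjoint (basesWith Q) (List.cons z '' basesOver z) := by
    rw [Set.disjoint_left]
    rintro _ ⟨-, h1, -⟩ ⟨t, -, rfl⟩
    exact hQ (h1 z rfl)
  have hsum : ∀ l ∈ List.cons z '' basesOver z, (0, PartColor.u) ∉ l := by
    rintro _ ⟨t, ht, rfl⟩
    simpa using ⟨hz.symm, ht.2⟩
  rw [baseGF, hunion, (summable_baseGF fun l hl => hl.2.2).tsum_union_disjoint hdisj
    (f := fun l => (MvPowerSeries.monomial (listExp l) 1 : GFSeries)) (summable_baseGF hsum),
    tsum_image (fun l => (MvPowerSeries.monomial (listExp l) 1 : GFSeries))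
      (List.cons_injective.injOn), baseGF, baseGF,
    ← (summable_baseGF fun l hl => hl.2).tsum_mul_left]
  simp only [listExp_cons, MvPowerSeries.monomial_mul_monomial, mul_one]

theorem coeff_baseGF {S : Set (List BasePart)} (hS : ∀ l ∈ S, (0, PartColor.u) ∉ l)
    (h0 : [] ∈ S) {d : GFVar →₀ ℕ} (hd : ∀ l ∈ S, l ≠ [] → d.degree < (listExp l).degree) :
    MvPowerSeries.coeff d (baseGF S) = MvPowerSeries.coeff d 1 := by
  classical
  have h := MvPowerSeries.WithPiTopology.hasSum_iff_hasSum_coeff.1 (summable_baseGF hS).hasSum d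
  have h' := hasSum_single (f := fun l : S => MvPowerSeries.coeff d
    (MvPowerSeries.monomial (listExp l) 1 : GFSeries)) ⟨[], h0⟩ (by
      rintro ⟨l, hl⟩ hne
      rw [MvPowerSeries.coeff_monomial, if_neg]
      rintro rfl
      exact lt_irrefl _ (hd l hl fun h => hne (Subtype.ext h)))
  rw [baseGF, h.unique h']
  rfl

theorem tendsto_baseGF (c : PartColor) :
    Filter.Tendsto (fun m : ℕ => baseGF (basesOver (m, c))) Filter.atTop (nhds 1) := by
  rw [MvPowerSeries.WithPiTopology.tendsto_iff_coeff_tendsto]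
  intro d
  refine tendsto_const_nhds.congr' ?_
  filter_upwards [Filter.eventually_gt_atTop d.degree] with m hm
  refine (coeff_baseGF (fun l hl => hl.2)
    (show [] ∈ basesOver (m, c) from ⟨by simp, by simp⟩) fun l hl hne => ?_).symm
  obtain ⟨x, t, rfl⟩ := List.exists_cons_of_ne_nil hne
  have h1 := le_of_isChain_baseRel hl.1 x (by simp)
  have h2 := (degree_listExp hl.2).2 x (by simp)
  simp only at h1
  omega

theorem monomial_partExp (x : BasePart) :
    (MvPowerSeries.monomial (partExp x) 1 : GFSeries) =
      MvPowerSeries.monomial (colorExp x.2) 1 * MvPowerSeries.X .q ^ (x.1 + colorShift x.2) := by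
  rw [MvPowerSeries.X_pow_eq, MvPowerSeries.monomial_mul_monomial, mul_one, partExp]

theorem baseGF_over_a (m : ℕ) :
    baseGF (basesOver (m, .a)) = baseGF (basesOver (m, .u)) +
      MvPowerSeries.X .b * MvPowerSeries.X .q ^ (m + 1) * baseGF (basesOver (m, .b)) := by
  rw [basesOver_eq (m, .a), baseGF_insert (Q := BaseRel (m, .u)) (z := (m, .b)) (by simp)
    (by simp [BaseRel, baseDiff]), ← basesOver_eq, monomial_partExp]
  · rfl
  · rintro ⟨n, k⟩ -
    cases k <;> simp [BaseRel, baseDiff] <;> omega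

theorem baseGF_over_b (m : ℕ) :
    baseGF (basesOver (m, .b)) = baseGF (basesOver (m, .u)) +
      MvPowerSeries.X .a * MvPowerSeries.X .q ^ m * baseGF (basesOver (m, .a)) := by
  rw [basesOver_eq (m, .b), baseGF_insert (Q := BaseRel (m, .u)) (z := (m, .a)) (by simp)
    (by simp [BaseRel, baseDiff]), ← basesOver_eq, monomial_partExp]
  · rfl
  · rintro ⟨n, k⟩ -
    cases k <;> simp [BaseRel, baseDiff] <;> omega

theorem baseGF_over_u_zero :
    baseGF (basesOver (0, .u)) = baseGF (basesOver (1, .a)) +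
      MvPowerSeries.X .a * MvPowerSeries.X .q * baseGF (basesOver (1, .a)) := by
  rw [basesOver_eq (0, .u), baseGF_insert (Q := BaseRel (1, .a)) (z := (1, .a)) (by simp)
    (by simp [BaseRel, baseDiff]), ← basesOver_eq, monomial_partExp]
  · simp [colorExp, colorShift, MvPowerSeries.X]
  · rintro ⟨n, k⟩ h
    cases k <;> simp [BaseRel, baseDiff] at h ⊢ <;> omega

theorem baseGF_over_u (m : ℕ) :
    baseGF (basesOver (m + 1, .u)) = baseGF (basesOver (m + 2, .a)) +
      MvPowerSeries.X .a * MvPowerSeries.X .q ^ (m + 2) * baseGF (basesOver (m + 2, .a)) +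
      MvPowerSeries.X .q ^ (m + 1) * baseGF (basesOver (m + 1, .u)) := by
  -- Compared with `(m+2)_a`, the part `(m+1)_u` admits just two more successors: itself and
  -- `(m+2)_a`. They are split off in turn.
  have h1 : baseGF (basesWith (BaseRel (m + 1, .u))) = _ :=
    baseGF_insert (z := (m + 1, .u)) (Q := fun x => BaseRel (m + 2, .a) x ∨ x = (m + 2, .a))
      (by simp) (by simp [BaseRel, baseDiff]) (by
        rintro ⟨n, k⟩ -
        cases k <;> simp [BaseRel, baseDiff] <;> omega)
  rw [baseGF_insert (Q := BaseRel (m + 2, .a)) (z := (m + 2, .a)) (by simp)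
    (by simp [BaseRel, baseDiff]) (fun x _ => Iff.rfl), ← basesOver_eq, ← basesOver_eq,
    monomial_partExp, monomial_partExp] at h1
  exact h1.trans (by simp [colorExp, colorShift, MvPowerSeries.X])

/-! ### Solving the recurrences as infinite products -/

section Product

variable {a b q : GFSeries}

/-- The elimination of `F_b` and `F_u`, iterated from level 0. The product of the `1 - q^m` is one
factor shorter because `0_u` is excluded at level 0. -/
theorem baseGF_mul_prod (ha : a = MvPowerSeries.X .a) (hb : b = MvPowerSeries.X .b)
    (hq : q = MvPowerSeries.X .q) (M : ℕ) :
    baseGF (basesOver (0, .a)) * ((∏ m ∈ Finset.range M, (1 - q * q ^ m)) *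
        ∏ m ∈ Finset.range (M + 1), (1 - a * b * q * (q ^ 2) ^ m)) =
      (∏ m ∈ Finset.range (M + 1), (1 - -(a * q) * q ^ m)) *
        (∏ m ∈ Finset.range (M + 1), (1 - -(b * q) * q ^ m)) *
          baseGF (basesOver (M + 1, .a)) := by
  induction M with
  | zero =>
    have h1 := baseGF_over_a 0
    have h2 := baseGF_over_b 0
    have h3 := baseGF_over_u_zero
    rw [← ha, ← hq] at h3
    rw [← hb, ← hq] at h1
    rw [← ha, ← hq] at h2
    simp only [Finset.range_zero, Finset.prod_empty, zero_add, Finset.prod_range_one, pow_zero]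
      at h1 h2 ⊢
    linear_combination h1 + b * q * h2 + (1 + b * q) * h3
  | succ M ih =>
    have h1 := baseGF_over_a (M + 1)
    have h2 := baseGF_over_b (M + 1)
    have h3 := baseGF_over_u M
    rw [← ha, ← hq] at h3
    rw [← hb, ← hq] at h1
    rw [← ha, ← hq] at h2
    have h4 : baseGF (basesOver (M + 1, .a)) * ((1 - q * q ^ M) *
        (1 - a * b * q * (q ^ 2) ^ (M + 1))) = (1 - -(a * q) * q ^ (M + 1)) *
        (1 - -(b * q) * q ^ (M + 1)) * baseGF (basesOver (M + 2, .a)) := by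
      linear_combination (1 - q * q ^ M) * h1 + (1 - q * q ^ M) * b * q ^ (M + 2) * h2 +
        (1 + b * q ^ (M + 2)) * h3
    rw [Finset.prod_range_succ _ M, Finset.prod_range_succ _ (M + 1),
      Finset.prod_range_succ _ (M + 1), Finset.prod_range_succ _ (M + 1)]
    linear_combination (1 - q * q ^ M) * (1 - a * b * q * (q ^ 2) ^ (M + 1)) * ih +
      (∏ m ∈ Finset.range (M + 1), (1 - -(a * q) * q ^ m)) *
        (∏ m ∈ Finset.range (M + 1), (1 - -(b * q) * q ^ m)) * h4

theorem tendsto_prod_qPochInf (x : GFSeries) {y : GFSeries}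
    (hy : MvPowerSeries.constantCoeff y = 0) :
    Filter.Tendsto (fun n => ∏ m ∈ Finset.range n, (1 - x * y ^ m)) Filter.atTop
      (nhds (qPochInf x y)) :=
  (multipliable_qPochInf x y hy).hasProd.tendsto_prod_nat

theorem constantCoeff_qPochInf {x y : GFSeries} (hx : MvPowerSeries.constantCoeff x = 0)
    (hy : MvPowerSeries.constantCoeff y = 0) :
    MvPowerSeries.constantCoeff (qPochInf x y) = 1 := by
  refine tendsto_nhds_unique (((MvPowerSeries.WithPiTopology.continuous_constantCoeff ℚ).tendsto
    _).comp (tendsto_prod_qPochInf x hy)) ?_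
  simp [Function.comp_def, hx]

theorem baseGF_eq (ha : a = MvPowerSeries.X .a) (hb : b = MvPowerSeries.X .b)
    (hq : q = MvPowerSeries.X .q) :
    baseGF (basesOver (0, .a)) = qPochInf (-(a * q)) q * qPochInf (-(b * q)) q *
      (qPochInf q q * qPochInf (a * b * q) (q ^ 2))⁻¹ := by
  have hq0 : MvPowerSeries.constantCoeff q = 0 := by simp [hq]
  have hq2 : MvPowerSeries.constantCoeff (q ^ 2) = 0 := by simp [hq]
  rw [MvPowerSeries.eq_mul_inv_iff_mul_eq (by
    rw [map_mul, constantCoeff_qPochInf hq0 hq0, constantCoeff_qPochInf (by simp [hq]) hq2]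
    simp)]
  have hs := Filter.tendsto_add_atTop_nat 1
  have h1 := ((tendsto_prod_qPochInf q hq0).mul
    ((tendsto_prod_qPochInf (a * b * q) hq2).comp hs)).const_mul (baseGF (basesOver (0, .a)))
  have h2 := (((tendsto_prod_qPochInf (-(a * q)) hq0).comp hs).mul
    ((tendsto_prod_qPochInf (-(b * q)) hq0).comp hs)).mul ((tendsto_baseGF .a).comp hs)
  rw [mul_one] at h2
  exact tendsto_nhds_unique h1 (h2.congr fun M => (baseGF_mul_prod ha hb hq M).symm)

theorem prod_q_eq_monomial (hq : q = MvPowerSeries.X .q) (D : Finset ℕ) :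
    ∏ i ∈ D, -(-q * q ^ i) =
      MvPowerSeries.monomial (Finsupp.single .q (∑ i ∈ D, (i + 1))) (1 : ℚ) := by
  rw [← MvPowerSeries.X_pow_eq, ← hq, ← Finset.prod_pow_eq_pow_sum]
  exact Finset.prod_congr rfl fun i _ => by ring

theorem lt_of_sum_succ_le {D : Finset ℕ} {n : ℕ} (h : ∑ i ∈ D, (i + 1) ≤ n) :
    D ∈ (Finset.range n).powerset := by
  rw [Finset.mem_powerset]
  intro i hi
  exact Finset.mem_range.2
    ((Finset.single_le_sum (f := fun i => i + 1) (fun _ _ => Nat.zero_le _) hi).trans h)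

/-- Expanding `∏ (1 + q^(i+1))` chooses a finite set of factors. -/
theorem hasSum_qPochInf_neg (hq : q = MvPowerSeries.X .q) :
    HasSum (fun D : Finset ℕ => (MvPowerSeries.monomial
      (Finsupp.single GFVar.q (∑ i ∈ D, (i + 1))) 1 : GFSeries)) (qPochInf (-q) q) := by
  have hs : Summable fun D : Finset ℕ => (MvPowerSeries.monomial
      (Finsupp.single GFVar.q (∑ i ∈ D, (i + 1))) 1 : GFSeries) :=
    summable_monomial fun d => ((Finset.range (d .q)).powerset.finite_toSet).subset fun D hD => by
      refine lt_of_sum_succ_le ?_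
      rw [← show _ = d from hD, Finsupp.single_eq_same]
  have h := hs
  simp only [← prod_q_eq_monomial hq] at h ⊢
  rw [qPochInf]
  simp only [sub_eq_add_neg]
  rw [tprod_one_add h]
  exact h.hasSum

end Product

/-! ### Assembling the generating function -/

theorem finite_encode_fiber (d : GFVar →₀ ℕ) :
    {p : basesOver (0, .a) × Finset ℕ |
      listExp p.1 + Finsupp.single .q (∑ i ∈ p.2, (i + 1)) = d}.Finite := by
  refine Set.Finite.of_finite_image (f := Prod.map Subtype.val id) ?_
    (Subtype.val_injective.prodMap Function.injective_id).injOn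
  refine ((finite_degree_listExp_le d.degree).prod
    (Finset.range d.degree).powerset.finite_toSet).subset ?_
  rintro _ ⟨⟨k, D⟩, rfl, rfl⟩
  simp only [map_add, Finsupp.degree_single, Prod.map_apply, id]
  exact ⟨⟨k.2.2, Nat.le_add_right _ _⟩, lt_of_sum_succ_le (Nat.le_add_left _ _)⟩

/-- The jagged overpartitions that satisfy the added condition. -/
abbrev CondJagged : Type := {l : List JPart // IsJaggedOverpartition l ∧ UCondition l}

/-- Jagged overpartitions that satisfy the added condition correspond to pairs of a base list without
parts `0_u` and a finite set. -/
noncomputable def encodeEquiv : basesOver (0, .a) × Finset ℕ ≃ CondJagged :=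
  Equiv.ofBijective (fun p => ⟨encode (p.1, p.2), mapsTo_encode ⟨p.1.2, trivial⟩⟩) (by
    constructor
    · rintro ⟨k, D⟩ ⟨k', D'⟩ h
      have := encode_injOn ⟨k.2, trivial⟩ ⟨k'.2, trivial⟩ (congrArg Subtype.val h)
      rw [Prod.mk.injEq] at this
      exact Prod.ext (Subtype.ext this.1) this.2
    · rintro ⟨l, hl⟩
      obtain ⟨⟨k, D⟩, ⟨hk, -⟩, h⟩ := surjOn_encode hl
      exact ⟨(⟨k, hk⟩, D), Subtype.ext h⟩)

theorem jaggedExp_encodeEquiv (p : basesOver (0, .a) × Finset ℕ) :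
    jaggedExp (encodeEquiv p).1 = listExp p.1 + Finsupp.single .q (∑ i ∈ p.2, (i + 1)) :=
  jaggedExp_encode (p.1, p.2)

theorem finite_jaggedExp_fiber (d : GFVar →₀ ℕ) : {l : CondJagged | jaggedExp l.1 = d}.Finite := by
  refine ((finite_encode_fiber d).image encodeEquiv).subset fun l hl => ?_
  refine ⟨encodeEquiv.symm l, ?_, encodeEquiv.apply_symm_apply l⟩
  rw [Set.mem_ofPred_eq, ← jaggedExp_encodeEquiv, encodeEquiv.apply_symm_apply]
  exact hl

theorem hasSum_jaggedExp {a b q : GFSeries} (ha : a = MvPowerSeries.X .a)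
    (hb : b = MvPowerSeries.X .b) (hq : q = MvPowerSeries.X .q) :
    HasSum (fun l : CondJagged => (MvPowerSeries.monomial (jaggedExp l.1) 1 : GFSeries))
      (qPochInf (-q) q * qPochInf (-(a * q)) q * qPochInf (-(b * q)) q *
          (qPochInf q q * qPochInf (a * b * q) (q ^ 2))⁻¹) := by
  have h1 : HasSum (fun l : basesOver (0, .a) =>
      (MvPowerSeries.monomial (listExp l) 1 : GFSeries)) _ :=
    (summable_baseGF fun l hl => hl.2).hasSum
  rw [← baseGF, baseGF_eq ha hb hq] at h1
  have hs := summable_monomial finite_encode_fiber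
  have h3 := h1.mul (hasSum_qPochInf_neg hq) (by
    simpa only [MvPowerSeries.monomial_mul_monomial, mul_one] using hs)
  rw [← encodeEquiv.hasSum_iff]
  simp only [Function.comp_def, jaggedExp_encodeEquiv]
  simp only [MvPowerSeries.monomial_mul_monomial, mul_one] at h3
  convert! h3 using 1
  ring

/-- The sum, the number of non-overlined parts, and the numbers of parts of colors `a` and `b`. -/
noncomputable def jaggedStats (l : CondJagged) : ℕ × ℕ × ℕ × ℕ :=
  ((l.1.map JPart.size).sum, l.1.countP (fun x => !x.overlined), numColor .a l.1, numColor .b l.1)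

theorem image_jaggedStats_fiber (n k i j : ℕ) :
    Subtype.val '' {l | jaggedStats l = (n, k, i, j)} = jaggedOverpartitions₁ n k i j := by
  ext l
  simp only [jaggedStats, jaggedOverpartitions₁, jaggedOverpartitions, Set.mem_image,
    Set.mem_ofPred_eq, Prod.mk.injEq, Subtype.exists, exists_and_right, exists_eq_right]
  tauto

theorem finite_jaggedStats_fiber (p : ℕ × ℕ × ℕ × ℕ) : {l | jaggedStats l = p}.Finite := by
  refine (finite_jaggedExp_fiber (Finsupp.single .a p.2.2.1 + Finsupp.single .b p.2.2.2 +
    Finsupp.single .q p.1)).subset ?_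
  rintro l rfl
  exact jaggedExp_eq l.1

theorem mainTheorem4 :
    (∀ n k i j : ℕ, (jaggedOverpartitions₁ n k i j).Finite) ∧
    ∀ a b q : GFSeries, a = MvPowerSeries.X .a → b = MvPowerSeries.X .b → q = MvPowerSeries.X .q →
      HasSum (fun p : ℕ × ℕ × ℕ × ℕ => match p with
          | (n, k, i, j) => (C₁ n k i j : GFSeries) * a ^ i * b ^ j * q ^ n)
        (qPochInf (-q) q * qPochInf (-(a * q)) q * qPochInf (-(b * q)) q *
          (qPochInf q q * qPochInf (a * b * q) (q ^ 2))⁻¹) := by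
  refine ⟨fun n k i j => ?_, fun a b q ha hb hq => ?_⟩
  · rw [← image_jaggedStats_fiber]
    exact (finite_jaggedStats_fiber _).image _
  · have h := hasSum_jaggedExp ha hb hq
    rw [← (Equiv.sigmaFiberEquiv jaggedStats).hasSum_iff] at h
    -- Group the sum by statistics. Each fiber is finite with constant monomial, since `k` carries
    -- no variable, so it contributes its cardinality times that monomial.
    refine h.sigma fun p => ?_
    obtain ⟨n, k, i, j⟩ := p
    have : Fintype {l // jaggedStats l = (n, k, i, j)} := (finite_jaggedStats_fiber _).fintype
    have hterm : ∀ l : {l // jaggedStats l = (n, k, i, j)},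
        (MvPowerSeries.monomial (jaggedExp l.1.1) 1 : GFSeries) = a ^ i * b ^ j * q ^ n := by
      rintro ⟨l, hl⟩
      simp only [jaggedStats, Prod.mk.injEq] at hl
      obtain ⟨h1, -, h2, h3⟩ := hl
      rw [ha, hb, hq, MvPowerSeries.X_pow_eq, MvPowerSeries.X_pow_eq, MvPowerSeries.X_pow_eq,
        MvPowerSeries.monomial_mul_monomial, MvPowerSeries.monomial_mul_monomial, jaggedExp_eq,
        h1, h2, h3, mul_one, mul_one]
    have hcard : C₁ n k i j = Nat.card {l // jaggedStats l = (n, k, i, j)} := by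
      rw [C₁, ← image_jaggedStats_fiber, Set.ncard_image_of_injective _ Subtype.val_injective,
        ← Nat.card_coe_set_eq]
      rfl
    convert hasSum_fintype _ using 1
    simp only [Function.comp_apply, Equiv.sigmaFiberEquiv_apply, hterm, Finset.sum_const,
      Finset.card_univ, nsmul_eq_mul, hcard, Nat.card_eq_fintype_card]
    ring
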